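/- Let $K\subset\mathbb R^2$ be a compact convex set with non-empty interior whose boundary $\gamma$ is a smooth ($C^\infty$) regular simple closed curve, positively oriented; $\gamma$ may contain line segments. Let $\omega$ be the standard area form on $\mathbb R^2$, $\nu_x$ the outward normal of $\gamma$ at $x$, and $$\mathcal P=\{(x,y)\in\gamma\times\gamma \mid \omega(\nu_x,\nu_y)>0\},$$ with the topology induced from $\gamma\times\gamma$. The symplectic billiard map is $\Phi:\mathcal P\to\mathcal P$, $\Phi(x,y)=(y,z)$, where $z\in\gamma$ is the unique point with $z\ne x$ such that $z-x$ is parallel to the tangent line $T_y\gamma$. (1) The set of 3-periodic points $\{p\in\mathcal P\mid \Phi^3(p)=p\}$ has empty interior in $\mathcal P$. (2) If $\gamma$ is strictly convex (that is, $K$ is strictly convex), then the set of 4-periodic points $\{p\in\mathcal P\mid \Phi^4(p)=p\}$ has empty interior in $\mathcal P$. -/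

import Mathlib

open scoped ContDiff

namespace SymplecticBilliard

/-- The Euclidean plane. -/
abbrev Plane : Type := EuclideanSpace ℝ (Fin 2)

/-- The standard area form on the plane. -/
def omega (u v : Plane) : ℝ := u 0 * v 1 - u 1 * v 0

/-- A smooth convex billiard table: a compact convex set with non-empty interior, whose boundary is
a smooth regular simple closed curve `curve`, parametrized with period `period` and positively
oriented (the interior of the table lies to the left of the curve).  Strict convexity is not part
of the definition: the curve may contain line segments. -/
structure ConvexTable where
  table : Set Plane
  isCompact_table : IsCompact table
  convex_table : Convex ℝ table
  nonempty_interior : (interior table).Nonempty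
  curve : ℝ → Plane
  period : ℝ
  period_pos : 0 < period
  smooth : ContDiff ℝ ∞ curve
  regular : ∀ t, deriv curve t ≠ 0
  periodic : Function.Periodic curve period
  simple : Set.InjOn curve (Set.Ico 0 period)
  range_curve : Set.range curve = frontier table
  positive : ∀ t, ∀ p ∈ interior table, 0 < omega (deriv curve t) (p - curve t)

namespace ConvexTable

variable (T : ConvexTable)

/-- The outward normal vector at the point `curve t`: the velocity turned clockwise by a right
angle. -/
noncomputable def outerNormal (t : ℝ) : Plane := !₂[deriv T.curve t 1, -deriv T.curve t 0]

/-- The direction of the tangent line of the curve at its point `y` (a line through the origin). -/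
noncomputable def tangent (y : Plane) : Submodule ℝ Plane :=
  Submodule.span ℝ (deriv T.curve '' (T.curve ⁻¹' {y}))

/-- The (open, positive part of the) phase space: the pairs `(x, y)` of points of the curve with
`ω(ν_x, ν_y) > 0`, where `ν` is the outward normal. -/
def phaseSpace : Set (Plane × Plane) :=
  {p | ∃ s t : ℝ, T.curve s = p.1 ∧ T.curve t = p.2 ∧
    0 < omega (T.outerNormal s) (T.outerNormal t)}

/-- `z` is the second point in which the line through `x` parallel to the tangent at `y` meets the
curve. -/
def IsReflection (x y z : Plane) : Prop :=
  z ∈ Set.range T.curve ∧ z ≠ x ∧ z - x ∈ T.tangent y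

theorem omega_outerNormal (s t : ℝ) :
    omega (T.outerNormal s) (T.outerNormal t) = omega (deriv T.curve s) (deriv T.curve t) := by
  simp [omega, outerNormal]; ring

theorem exists_int_of_curve_eq {s t : ℝ} (h : T.curve s = T.curve t) :
    ∃ n : ℤ, t = s + n * T.period := by
  have e1 : toIcoMod T.period_pos 0 s = toIcoMod T.period_pos 0 t := by
    apply T.simple
    · simpa using toIcoMod_mem_Ico T.period_pos 0 s
    · simpa using toIcoMod_mem_Ico T.period_pos 0 t
    · rw [toIcoMod, toIcoMod, T.periodic.sub_zsmul_eq, T.periodic.sub_zsmul_eq, h]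
  refine ⟨toIcoDiv T.period_pos 0 t - toIcoDiv T.period_pos 0 s, ?_⟩
  simp only [toIcoMod, zsmul_eq_mul] at e1
  push_cast
  linarith

theorem deriv_curve_eq {s t : ℝ} (h : T.curve s = T.curve t) :
    deriv T.curve s = deriv T.curve t := by
  obtain ⟨n, rfl⟩ := T.exists_int_of_curve_eq h
  have hp : (fun x => T.curve (x + n * T.period)) = T.curve := by
    funext x
    exact T.periodic.int_mul n x
  have := deriv_comp_add_const T.curve (n * T.period) s
  rw [hp] at this
  exact this

theorem mem_tangent {t : ℝ} {v : Plane} :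
    v ∈ T.tangent (T.curve t) ↔ ∃ c : ℝ, v = c • deriv T.curve t := by
  have : deriv T.curve '' (T.curve ⁻¹' {T.curve t}) = {deriv T.curve t} := by
    ext w
    constructor
    · rintro ⟨s, hs, rfl⟩
      exact T.deriv_curve_eq hs
    · rintro rfl
      exact ⟨t, rfl, rfl⟩
  rw [tangent, this, Submodule.mem_span_singleton]
  exact ⟨fun ⟨c, hc⟩ => ⟨c, hc.symm⟩, fun ⟨c, hc⟩ => ⟨c, hc.symm⟩⟩

theorem hasDerivAt_omega_curve (v x : Plane) (s : ℝ) :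
    HasDerivAt (fun u => omega (T.curve u - x) v) (omega (deriv T.curve s) v) s := by
  have hd : HasDerivAt T.curve (deriv T.curve s) s :=
    ((T.smooth.differentiable (by simp)) s).hasDerivAt
  have hi : ∀ i : Fin 2, HasDerivAt (fun u => T.curve u i) (deriv T.curve s i) s := fun i =>
    (EuclideanSpace.proj i : Plane →L[ℝ] ℝ).hasFDerivAt.comp_hasDerivAt s hd
  have h := (((hi 0).sub_const (x 0)).mul_const (v 1)).sub
    (((hi 1).sub_const (x 1)).mul_const (v 0))
  exact h

theorem support (s u : ℝ) : 0 ≤ omega (deriv T.curve s) (T.curve u - T.curve s) := by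
  have hcl : closure (interior T.table) = closure T.table :=
    T.convex_table.closure_interior_eq_closure_of_nonempty_interior T.nonempty_interior
  have hu : T.curve u ∈ closure (interior T.table) := by
    rw [hcl]
    have : T.curve u ∈ frontier T.table := T.range_curve ▸ Set.mem_range_self u
    exact this.1
  have hc : IsClosed {p : Plane | 0 ≤ omega (deriv T.curve s) (p - T.curve s)} := by
    apply isClosed_le continuous_const
    unfold omega
    fun_prop
  exact closure_minimal (fun p hp => (T.positive s p hp).le) hc hu

theorem omega_pos_of_isReflection {s t u : ℝ}
    (h : 0 < omega (deriv T.curve s) (deriv T.curve t))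
    (hz : T.IsReflection (T.curve s) (T.curve t) (T.curve u)) :
    (∃ c : ℝ, 0 < c ∧ T.curve u - T.curve s = c • deriv T.curve t) ∧
      0 < omega (deriv T.curve t) (deriv T.curve u) := by
  obtain ⟨-, hne, hmem⟩ := hz
  obtain ⟨c, hc⟩ := T.mem_tangent.1 hmem
  have hc0 : c ≠ 0 := by
    rintro rfl
    exact hne (sub_eq_zero.1 (by simpa using hc))
  have h0 := congrArg (fun v : Plane => v 0) hc
  have h1 := congrArg (fun v : Plane => v 1) hc
  simp only [PiLp.sub_apply, PiLp.smul_apply, smul_eq_mul] at h0 h1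
  have S1 := T.support s u
  have S2 := T.support u s
  have hcpos : 0 < c := by
    have : omega (deriv T.curve s) (T.curve u - T.curve s)
        = c * omega (deriv T.curve s) (deriv T.curve t) := by
      simp only [omega, PiLp.sub_apply, h0, h1]; ring
    rw [this] at S1
    have := nonneg_of_mul_nonneg_left S1 h
    exact lt_of_le_of_ne this hc0.symm
  have hnn : 0 ≤ omega (deriv T.curve t) (deriv T.curve u) := by
    have : omega (deriv T.curve u) (T.curve s - T.curve u)
        = c * omega (deriv T.curve t) (deriv T.curve u) := by
      have h0' : T.curve s 0 - T.curve u 0 = -(c * deriv T.curve t 0) := by linarith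
      have h1' : T.curve s 1 - T.curve u 1 = -(c * deriv T.curve t 1) := by linarith
      simp only [omega, PiLp.sub_apply, h0', h1']; ring
    rw [this] at S2
    exact nonneg_of_mul_nonneg_right S2 hcpos
  refine ⟨⟨c, hcpos, hc⟩, lt_of_le_of_ne hnn ?_⟩
  intro hz
  -- if the tangents at `t` and `u` were parallel, the line through the point `s` would be a
  -- supporting line of the table, hence the tangent at `s`
  have key : omega (deriv T.curve s) (deriv T.curve u) = 0 := by
    have hd := T.hasDerivAt_omega_curve (deriv T.curve u) (T.curve u) s
    have hmax : IsLocalMax (fun v => omega (T.curve v - T.curve u) (deriv T.curve u)) s := by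
      apply Filter.Eventually.of_forall
      intro v
      have S := T.support u v
      have e1 : omega (T.curve v - T.curve u) (deriv T.curve u)
          = - omega (deriv T.curve u) (T.curve v - T.curve u) := by
        simp only [omega]; ring
      have e2 : omega (T.curve s - T.curve u) (deriv T.curve u)
          = - c * omega (deriv T.curve t) (deriv T.curve u) := by
        have h0' : T.curve s 0 - T.curve u 0 = -(c * deriv T.curve t 0) := by linarith
        have h1' : T.curve s 1 - T.curve u 1 = -(c * deriv T.curve t 1) := by linarith
        simp only [omega, PiLp.sub_apply, h0', h1']; ring
      simp only [e1, e2, ← hz]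
      linarith
    exact hmax.hasDerivAt_eq_zero hd
  apply T.regular u
  simp only [omega] at h hz key
  have hu0 : deriv T.curve u 0 = 0 := by
    have : deriv T.curve u 0 *
        (deriv T.curve s 0 * deriv T.curve t 1 - deriv T.curve s 1 * deriv T.curve t 0) = 0 := by
      linear_combination deriv T.curve t 0 * key + deriv T.curve s 0 * hz
    exact (mul_eq_zero.1 this).resolve_right h.ne'
  have hu1 : deriv T.curve u 1 = 0 := by
    have : deriv T.curve u 1 *
        (deriv T.curve s 0 * deriv T.curve t 1 - deriv T.curve s 1 * deriv T.curve t 0) = 0 := by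
      linear_combination deriv T.curve t 1 * key + deriv T.curve s 1 * hz
    exact (mul_eq_zero.1 this).resolve_right h.ne'
  ext i
  fin_cases i
  · exact hu0
  · exact hu1

theorem exists_isReflection {s t : ℝ} (h : 0 < omega (deriv T.curve s) (deriv T.curve t)) :
    ∃ u, T.IsReflection (T.curve s) (T.curve t) (T.curve u) := by
  set f : ℝ → ℝ := fun u => omega (T.curve u - T.curve s) (deriv T.curve t) with hf
  have hfs : f s = 0 := by simp [hf, omega]
  have hcont : Continuous f :=
    continuous_iff_continuousAt.2 fun u => (T.hasDerivAt_omega_curve _ _ u).continuousAt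
  have hper : ∀ u, f (u + T.period) = f u := fun u => by simp only [hf, T.periodic u]
  have hL := T.period_pos
  have hslope := (hasDerivAt_iff_tendsto_slope.1
    (T.hasDerivAt_omega_curve (deriv T.curve t) (T.curve s) s)).eventually (lt_mem_nhds h)
  obtain ⟨ε, hε, hball⟩ := Metric.mem_nhdsWithin_iff.1 hslope
  obtain ⟨δ, hδ0, hδε, hδL⟩ : ∃ δ : ℝ, 0 < δ ∧ δ < ε ∧ δ < T.period / 2 :=
    ⟨min ε (T.period / 2) / 2, by positivity,
      by have := min_le_left ε (T.period / 2); linarith,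
      by have := min_le_right ε (T.period / 2); linarith⟩
  have hpos : 0 < f (s + δ) := by
    have : s + δ ∈ Metric.ball s ε ∩ {s}ᶜ := by
      constructor
      · simpa [Real.dist_eq, abs_of_pos hδ0] using hδε
      · simpa using hδ0.ne'
    have h2 : 0 < slope f s (s + δ) := hball this
    rw [slope_def_field, hfs, sub_zero, add_sub_cancel_left] at h2
    exact (div_pos_iff_of_pos_right hδ0).1 h2
  have hneg : f (s + T.period - δ) < 0 := by
    have : s - δ ∈ Metric.ball s ε ∩ {s}ᶜ := by
      constructor
      · simpa [Real.dist_eq, abs_of_pos hδ0] using hδε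
      · simpa using hδ0.ne'
    have h2 : 0 < slope f s (s - δ) := hball this
    have e : s + T.period - δ = (s - δ) + T.period := by ring
    rw [e, hper]
    rw [slope_def_field, hfs, sub_zero] at h2
    have e2 : s - δ - s = -δ := by ring
    rw [e2, div_neg, neg_pos] at h2
    by_contra hcon
    exact absurd (div_nonneg (not_lt.1 hcon) hδ0.le) (not_le.2 h2)
  obtain ⟨u, ⟨hu1, hu2⟩, hfu⟩ := intermediate_value_Icc' (a := s + δ) (b := s + T.period - δ)
    (by linarith) hcont.continuousOn ⟨hneg.le, hpos.le⟩
  refine ⟨u, Set.mem_range_self u, ?_, ?_⟩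
  · intro heq
    obtain ⟨n, hn⟩ := T.exists_int_of_curve_eq heq.symm
    have a1 : (0 : ℝ) < n := by
      by_contra hcon
      have := mul_nonpos_of_nonpos_of_nonneg (not_lt.1 hcon) hL.le
      linarith
    have a2 : (n : ℝ) < 1 := by
      by_contra hcon
      have := mul_le_mul_of_nonneg_right (not_lt.1 hcon) hL.le
      linarith
    have b1 : (0 : ℤ) < n := by exact_mod_cast a1
    have b2 : n < (1 : ℤ) := by exact_mod_cast a2
    omega
  · rw [T.mem_tangent]
    simp only [hf, SymplecticBilliard.omega, PiLp.sub_apply] at hfu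
    by_cases hv : deriv T.curve t 0 = 0
    · have hv1 : deriv T.curve t 1 ≠ 0 := by
        intro h1
        simp [SymplecticBilliard.omega, hv, h1] at h
      refine ⟨(T.curve u 1 - T.curve s 1) / deriv T.curve t 1, ?_⟩
      rw [hv, mul_zero, sub_zero] at hfu
      have := (mul_eq_zero.1 hfu).resolve_right hv1
      ext i
      fin_cases i
      · simp [hv, this]
      · simp [div_mul_cancel₀ _ hv1]
    · refine ⟨(T.curve u 0 - T.curve s 0) / deriv T.curve t 0, ?_⟩
      ext i
      fin_cases i
      · simp [div_mul_cancel₀ _ hv]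
      · simp only [Fin.mk_one, PiLp.sub_apply, PiLp.smul_apply, smul_eq_mul]
        field_simp
        linarith

/-- The reflection law is well defined: for `(x, y)` in the phase space the reflected point `z`
exists and is unique. -/
theorem existsUnique_isReflection {p : Plane × Plane} (hp : p ∈ T.phaseSpace) :
    ∃! z, T.IsReflection p.1 p.2 z := by
  obtain ⟨x, y⟩ := p
  obtain ⟨s, t, rfl, rfl, h⟩ := hp
  rw [omega_outerNormal] at h
  obtain ⟨u, hu⟩ := T.exists_isReflection h
  refine ⟨T.curve u, hu, ?_⟩
  rintro z hz
  obtain ⟨v, rfl⟩ := hz.1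
  obtain ⟨⟨c, hc, hcu⟩, hpu⟩ := T.omega_pos_of_isReflection h hu
  obtain ⟨⟨d, hd, hdv⟩, hpv⟩ := T.omega_pos_of_isReflection h hz
  have h0 := congrArg (fun v : Plane => v 0) hcu
  have h1 := congrArg (fun v : Plane => v 1) hcu
  have k0 := congrArg (fun v : Plane => v 0) hdv
  have k1 := congrArg (fun v : Plane => v 1) hdv
  simp only [PiLp.sub_apply, PiLp.smul_apply, smul_eq_mul] at h0 h1 k0 k1
  have S1 := T.support u v
  have S2 := T.support v u
  have e0 : T.curve v 0 - T.curve u 0 = (d - c) * deriv T.curve t 0 := by linarith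
  have e1 : T.curve v 1 - T.curve u 1 = (d - c) * deriv T.curve t 1 := by linarith
  have f0 : T.curve u 0 - T.curve v 0 = (c - d) * deriv T.curve t 0 := by linarith
  have f1 : T.curve u 1 - T.curve v 1 = (c - d) * deriv T.curve t 1 := by linarith
  have E1 : omega (deriv T.curve u) (T.curve v - T.curve u)
      = (c - d) * omega (deriv T.curve t) (deriv T.curve u) := by
    simp only [omega, PiLp.sub_apply, e0, e1]; ring
  have E2 : omega (deriv T.curve v) (T.curve u - T.curve v)
      = (d - c) * omega (deriv T.curve t) (deriv T.curve v) := by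
    simp only [omega, PiLp.sub_apply, f0, f1]; ring
  rw [E1] at S1
  rw [E2] at S2
  have i1 := nonneg_of_mul_nonneg_left S1 hpu
  have i2 := nonneg_of_mul_nonneg_left S2 hpv
  have hcd : d = c := by linarith
  rw [hcd, ← hcu] at hdv
  exact sub_left_injective hdv

/-- The pair `(y, z)` lies again in the phase space. -/
theorem mem_phaseSpace_of_isReflection {p : Plane × Plane} (hp : p ∈ T.phaseSpace) {z : Plane}
    (hz : T.IsReflection p.1 p.2 z) : (p.2, z) ∈ T.phaseSpace := by
  obtain ⟨x, y⟩ := p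
  obtain ⟨s, t, rfl, rfl, h⟩ := hp
  rw [omega_outerNormal] at h
  obtain ⟨u, rfl⟩ := hz.1
  refine ⟨t, u, rfl, rfl, ?_⟩
  rw [omega_outerNormal]
  exact (T.omega_pos_of_isReflection h hz).2

/-- The symplectic billiard map `(x, y) ↦ (y, z)` of the phase space to itself, where `z ≠ x` is the
point of the curve such that the chord `x z` is parallel to the tangent at `y`. -/
noncomputable def billiardMap (p : T.phaseSpace) : T.phaseSpace :=
  ⟨(p.1.2, (T.existsUnique_isReflection p.2).choose),
    T.mem_phaseSpace_of_isReflection p.2 (T.existsUnique_isReflection p.2).choose_spec.1⟩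

end ConvexTable

end SymplecticBilliard

namespace SymplecticBilliard

open Filter Topology

/-! If periodic points filled an open set, one could fix the first point `x` of a periodic pair and
let the second point `y` run along an arc of the curve. Both parts show that such periodic orbits
are too rigid for this.

Period 3: each orbit is an inscribed triangle whose sides are parallel to the tangents at the
opposite vertices. For two such triangles with common vertex `x`, convexity bounds the mixed
products of base and height by the pure ones, and the equality case of AM-GM makes the heights over
`x` equal (`height_eq_of_support`). But the height of `y` has nonzero derivative along the curve,
because `ω(ν_x, ν_y) > 0`.

Period 4: the tangents at `x` and at the third point `z` are antiparallel. Under strict convexity an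
oriented tangent direction determines its point (`curve_eq_of_deriv_eq_smul`), so `x` determines
`z`; the chord `xz` then gives the tangent direction at `y`, hence `y` itself. -/

theorem omega_smul_left (c : ℝ) (u v : Plane) : omega (c • u) v = c * omega u v := by
  simp only [omega, PiLp.smul_apply, smul_eq_mul]; ring

theorem omega_smul_right (c : ℝ) (u v : Plane) : omega u (c • v) = c * omega u v := by
  simp only [omega, PiLp.smul_apply, smul_eq_mul]; ring

theorem omega_add_right (u v w : Plane) : omega u (v + w) = omega u v + omega u w := by
  simp only [omega, PiLp.add_apply]; ring

theorem omega_swap (u v : Plane) : omega u v = -omega v u := by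
  simp only [omega]; ring

/-! ### Rigidity of the height of a triangle -/

/-- Two positive pairs `(e₁, h₁)`, `(e₂, h₂)` whose mixed products are dominated on average by
both pure products have the same second entry. -/
theorem eq_of_mixed_products_le {e₁ e₂ h₁ h₂ : ℝ} (he₁ : 0 < e₁) (he₂ : 0 < e₂) (hh₁ : 0 < h₁)
    (hh₂ : 0 < h₂) (H₁ : e₁ * h₂ + e₂ * h₁ ≤ 2 * (e₁ * h₁))
    (H₂ : e₁ * h₂ + e₂ * h₁ ≤ 2 * (e₂ * h₂)) : h₁ = h₂ := by
  have hp : 0 < e₁ * h₂ + e₂ * h₁ := by positivity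
  -- The product of the hypotheses bounds the square of the sum of `e₁ * h₂` and `e₂ * h₁` by four
  -- times their product: reversed AM-GM, so the two are equal.
  have hsq := mul_le_mul H₁ H₂ hp.le (by positivity)
  have hm : e₁ * h₂ = e₂ * h₁ := by
    have : (e₁ * h₂ - e₂ * h₁) ^ 2 ≤ 0 := by linarith
    exact sub_eq_zero.1 (pow_eq_zero_iff two_ne_zero |>.1 (le_antisymm this (sq_nonneg _)))
  have h21 : h₂ ≤ h₁ := le_of_mul_le_mul_left (by linarith) he₁
  have h12 : h₁ ≤ h₂ := le_of_mul_le_mul_left (by linarith) he₂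
  exact le_antisymm h12 h21

/-- Two triangles with common vertex `x`, the sides opposite to `x` being parallel to `v`, such that
each of the other vertices lies on the inner side of the line which passes through the
corresponding vertex of the other triangle in the direction of the side opposite to that vertex,
have the same height over `x`. -/
theorem height_eq_of_support {x v y₁ z₁ y₂ z₂ : Plane} {e₁ e₂ : ℝ} (he₁ : 0 < e₁) (he₂ : 0 < e₂)
    (hyz₁ : y₁ - z₁ = e₁ • v) (hyz₂ : y₂ - z₂ = e₂ • v)
    (hh₁ : 0 < omega v (y₁ - x)) (hh₂ : 0 < omega v (y₂ - x))
    (hy₁ : 0 ≤ omega (z₁ - x) (y₂ - y₁)) (hz₁ : 0 ≤ omega (x - y₁) (z₂ - z₁))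
    (hy₂ : 0 ≤ omega (z₂ - x) (y₁ - y₂)) (hz₂ : 0 ≤ omega (x - y₂) (z₁ - z₂)) :
    omega v (y₁ - x) = omega v (y₂ - x) := by
  obtain rfl : z₁ = y₁ - e₁ • v := by rw [← hyz₁]; abel
  obtain rfl : z₂ = y₂ - e₂ • v := by rw [← hyz₂]; abel
  apply eq_of_mixed_products_le he₁ he₂ hh₁ hh₂
  -- For each triangle, the required inequality is the sum of the two support inequalities at its
  -- vertices `y` and `z`.
  all_goals
    simp only [omega, PiLp.sub_apply, PiLp.smul_apply, smul_eq_mul] at *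
    linarith

namespace ConvexTable

variable (T : ConvexTable)

/-! ### Periodic orbits as inscribed polygons -/

theorem continuous_omega_deriv (v : Plane) :
    Continuous fun r => omega v (deriv T.curve r) := by
  have : Continuous (deriv T.curve) := T.smooth.continuous_deriv (by simp)
  unfold omega
  fun_prop

/-- A point in the interior of a subset of the phase space can be moved within that subset by
varying its second component only. -/
theorem eventually_mem_of_mem_interior {S : Set T.phaseSpace} {p : T.phaseSpace}
    (hp : p ∈ interior S) :
    ∃ s t : ℝ, 0 < omega (deriv T.curve s) (deriv T.curve t) ∧
      ∀ᶠ r in 𝓝 t, 0 < omega (deriv T.curve s) (deriv T.curve r) ∧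
        ∃ q ∈ S, q.1 = (T.curve s, T.curve r) := by
  obtain ⟨s, t, hs, ht, h⟩ := p.2
  rw [omega_outerNormal] at h
  refine ⟨s, t, h, ?_⟩
  obtain ⟨U, hU, hUS⟩ := mem_nhds_subtype _ _ _ |>.1 (mem_interior_iff_mem_nhds.1 hp)
  rw [← show (T.curve s, T.curve t) = p.1 from Prod.ext hs ht] at hU
  have hc : Continuous fun r => (T.curve s, T.curve r) :=
    continuous_const.prodMk T.smooth.continuous
  filter_upwards [hc.continuousAt.preimage_mem_nhds hU,
    (T.continuous_omega_deriv (deriv T.curve s)).continuousAt.eventually (lt_mem_nhds h)]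
    with r hr hpos
  refine ⟨hpos, ⟨(T.curve s, T.curve r), s, r, rfl, rfl, ?_⟩, hUS hr, rfl⟩
  rwa [omega_outerNormal]

theorem exists_billiardMap_eq {p : T.phaseSpace} {s t : ℝ} (hp : p.1 = (T.curve s, T.curve t))
    (h : 0 < omega (deriv T.curve s) (deriv T.curve t)) :
    ∃ u c : ℝ, 0 < c ∧ T.curve u - T.curve s = c • deriv T.curve t ∧
      0 < omega (deriv T.curve t) (deriv T.curve u) ∧
      (T.billiardMap p).1 = (T.curve t, T.curve u) := by
  have hr : T.IsReflection p.1.1 p.1.2 (T.billiardMap p).1.2 :=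
    (T.existsUnique_isReflection p.2).choose_spec.1
  have hfst : (T.billiardMap p).1.1 = p.1.2 := rfl
  obtain ⟨u, hu⟩ := hr.1
  rw [← hu, hp] at hr
  obtain ⟨⟨c, hc, hcu⟩, hpos⟩ := T.omega_pos_of_isReflection h hr
  exact ⟨u, c, hc, hcu, hpos, Prod.ext (by rw [hfst, hp]) hu.symm⟩

/-- A 3-periodic point gives an inscribed triangle whose sides are parallel to the tangents at the
opposite vertices. -/
theorem exists_triangle_of_isPeriodicPt {p : T.phaseSpace} {s t : ℝ}
    (hp : p.1 = (T.curve s, T.curve t)) (h : 0 < omega (deriv T.curve s) (deriv T.curve t))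
    (hper : Function.IsPeriodicPt T.billiardMap 3 p) :
    ∃ u c d e : ℝ, 0 < c ∧ 0 < d ∧ 0 < e ∧ T.curve u - T.curve s = c • deriv T.curve t ∧
      T.curve s - T.curve t = d • deriv T.curve u ∧
      T.curve t - T.curve u = e • deriv T.curve s := by
  obtain ⟨u, c, hc, hcu, hu, hp₁⟩ := T.exists_billiardMap_eq hp h
  obtain ⟨v, d, hd, hdv, hv, hp₂⟩ := T.exists_billiardMap_eq hp₁ hu
  obtain ⟨w, e, he, hew, -, hp₃⟩ := T.exists_billiardMap_eq hp₂ hv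
  have hper' : T.billiardMap (T.billiardMap (T.billiardMap p)) = p := hper
  rw [hper', hp, Prod.mk.injEq] at hp₃
  -- The orbit closes up: the fourth and fifth points are the first two.
  rw [← hp₃.1] at hdv
  rw [← hp₃.2, ← T.deriv_curve_eq hp₃.1] at hew
  exact ⟨u, c, d, e, hc, hd, he, hcu, hdv, hew⟩

/-- A 4-periodic point gives an inscribed quadrilateral whose tangents at opposite vertices are
antiparallel. -/
theorem exists_antiparallel_of_isPeriodicPt {p : T.phaseSpace} {s t : ℝ}
    (hp : p.1 = (T.curve s, T.curve t)) (h : 0 < omega (deriv T.curve s) (deriv T.curve t))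
    (hper : Function.IsPeriodicPt T.billiardMap 4 p) :
    ∃ u c k : ℝ, 0 < c ∧ 0 < k ∧ T.curve u - T.curve s = c • deriv T.curve t ∧
      deriv T.curve s = -(k • deriv T.curve u) := by
  obtain ⟨u, c, hc, hcu, hu, hp₁⟩ := T.exists_billiardMap_eq hp h
  obtain ⟨v, d, hd, hdv, hv, hp₂⟩ := T.exists_billiardMap_eq hp₁ hu
  obtain ⟨w, e, he, hew, hw, hp₃⟩ := T.exists_billiardMap_eq hp₂ hv
  obtain ⟨r, f, hf, hfr, -, hp₄⟩ := T.exists_billiardMap_eq hp₃ hw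
  have hper' : T.billiardMap (T.billiardMap (T.billiardMap (T.billiardMap p))) = p := hper
  rw [hper', hp, Prod.mk.injEq] at hp₄
  rw [← hp₄.2, ← T.deriv_curve_eq hp₄.1] at hfr
  -- The second and fourth points span a chord parallel to the tangents at both other vertices; it
  -- is traversed once each way, whence the sign and the ratio `d / f`.
  refine ⟨u, c, f⁻¹ * d, hc, by positivity, hcu, ?_⟩
  rw [mul_smul, ← hdv, ← smul_neg, neg_sub, hfr, inv_smul_smul₀ hf.ne']

/-- The sides through the common vertex are positive multiples of tangents at the opposite vertices,
so the hypotheses of `height_eq_of_support` are the supporting line inequalities of the table. -/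
theorem omega_deriv_eq_of_triangles {s t₁ t₂ u₁ u₂ c₁ c₂ d₁ d₂ e₁ e₂ : ℝ}
    (h₁ : 0 < omega (deriv T.curve s) (deriv T.curve t₁))
    (h₂ : 0 < omega (deriv T.curve s) (deriv T.curve t₂))
    (hc₁ : 0 < c₁) (hd₁ : 0 < d₁) (he₁ : 0 < e₁) (hc₂ : 0 < c₂) (hd₂ : 0 < d₂) (he₂ : 0 < e₂)
    (hcu₁ : T.curve u₁ - T.curve s = c₁ • deriv T.curve t₁)
    (hdu₁ : T.curve s - T.curve t₁ = d₁ • deriv T.curve u₁)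
    (heu₁ : T.curve t₁ - T.curve u₁ = e₁ • deriv T.curve s)
    (hcu₂ : T.curve u₂ - T.curve s = c₂ • deriv T.curve t₂)
    (hdu₂ : T.curve s - T.curve t₂ = d₂ • deriv T.curve u₂)
    (heu₂ : T.curve t₂ - T.curve u₂ = e₂ • deriv T.curve s) :
    omega (deriv T.curve s) (T.curve t₁ - T.curve s) =
      omega (deriv T.curve s) (T.curve t₂ - T.curve s) := by
  have height {t u c e : ℝ} (h : 0 < omega (deriv T.curve s) (deriv T.curve t)) (hc : 0 < c)
      (hcu : T.curve u - T.curve s = c • deriv T.curve t)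
      (heu : T.curve t - T.curve u = e • deriv T.curve s) :
      0 < omega (deriv T.curve s) (T.curve t - T.curve s) := by
    have : T.curve t - T.curve s = c • deriv T.curve t + e • deriv T.curve s := by
      rw [← hcu, ← heu]; abel
    have hself : omega (deriv T.curve s) (deriv T.curve s) = 0 := by simp only [omega]; ring
    rw [this, omega_add_right, omega_smul_right, omega_smul_right, hself, mul_zero, add_zero]
    positivity
  have support_smul {a b c : ℝ} {v : Plane} (hc : 0 < c) (hv : v = c • deriv T.curve a) :
      0 ≤ omega v (T.curve b - T.curve a) := by
    rw [hv, omega_smul_left]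
    exact mul_nonneg hc.le (T.support a b)
  exact height_eq_of_support he₁ he₂ heu₁ heu₂ (height h₁ hc₁ hcu₁ heu₁) (height h₂ hc₂ hcu₂ heu₂)
    (support_smul hc₁ hcu₁) (support_smul hd₁ hdu₁) (support_smul hc₂ hcu₂) (support_smul hd₂ hdu₂)

theorem curve_mem_table (t : ℝ) : T.curve t ∈ T.table := by
  have : T.curve t ∈ frontier T.table := T.range_curve ▸ Set.mem_range_self t
  exact T.isCompact_table.isClosed.frontier_subset this

/-- On a strictly convex table, a boundary point is determined by the direction of its oriented
tangent. -/
theorem curve_eq_of_deriv_eq_smul (hT : StrictConvex ℝ T.table) {a b k : ℝ} (hk : 0 < k)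
    (h : deriv T.curve a = k • deriv T.curve b) : T.curve a = T.curve b := by
  by_contra hne
  have hmid := hT (T.curve_mem_table a) (T.curve_mem_table b) hne
    (show (0 : ℝ) < 1 / 2 by norm_num) (show (0 : ℝ) < 1 / 2 by norm_num) (by norm_num)
  -- The two tangent lines are parallel with the same orientation. The one at `b` puts `a` weakly to
  -- its left, while the interior midpoint puts `b` strictly to the left of the one at `a`.
  have hb := mul_nonneg hk.le (T.support b a)
  rw [← omega_smul_left, ← h] at hb
  have hpos := T.positive a _ hmid
  simp only [omega, PiLp.sub_apply, PiLp.add_apply, PiLp.smul_apply, smul_eq_mul] at hb hpos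
  linarith

theorem interior_isPeriodicPt_three :
    interior {p : T.phaseSpace | Function.IsPeriodicPt T.billiardMap 3 p} = ∅ := by
  refine Set.eq_empty_of_forall_notMem fun p hp => ?_
  obtain ⟨s, t, h, hev⟩ := T.eventually_mem_of_mem_interior hp
  obtain ⟨-, q, hq, hqt⟩ := hev.self_of_nhds
  obtain ⟨u, c, d, e, hc, hd, he, hcu, hdu, heu⟩ := T.exists_triangle_of_isPeriodicPt hqt h hq
  have hne : ∀ᶠ r in 𝓝[≠] t, omega (T.curve r - T.curve s) (deriv T.curve s) ≠
      omega (T.curve t - T.curve s) (deriv T.curve s) := by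
    -- The height over the tangent at `s` has nonzero derivative at `t`, so it differs from its
    -- value there at nearby parameters.
    apply (T.hasDerivAt_omega_curve _ _ t).eventually_ne
    rw [omega_swap]
    exact neg_ne_zero.2 h.ne'
  obtain ⟨r, hrne, hr, q', hq', hqr⟩ := (hne.and (hev.filter_mono nhdsWithin_le_nhds)).exists
  obtain ⟨u', c', d', e', hc', hd', he', hcu', hdu', heu'⟩ :=
    T.exists_triangle_of_isPeriodicPt hqr hr hq'
  apply hrne
  rw [omega_swap, omega_swap (T.curve t - T.curve s),
    T.omega_deriv_eq_of_triangles hr h hc' hd' he' hc hd he hcu' hdu' heu' hcu hdu heu]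

theorem interior_isPeriodicPt_four (hT : StrictConvex ℝ T.table) :
    interior {p : T.phaseSpace | Function.IsPeriodicPt T.billiardMap 4 p} = ∅ := by
  refine Set.eq_empty_of_forall_notMem fun p hp => ?_
  obtain ⟨s, t, h, hev⟩ := T.eventually_mem_of_mem_interior hp
  obtain ⟨-, q, hq, hqt⟩ := hev.self_of_nhds
  obtain ⟨u, c, k, hc, hk, hcu, hku⟩ := T.exists_antiparallel_of_isPeriodicPt hqt h hq
  have hne : ∀ᶠ r in 𝓝[≠] t, T.curve r ≠ T.curve t :=
    ((T.smooth.differentiable (by simp)) t).hasDerivAt.eventually_ne (T.regular t)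
  obtain ⟨r, hrne, hr, q', hq', hqr⟩ := (hne.and (hev.filter_mono nhdsWithin_le_nhds)).exists
  obtain ⟨u', c', k', hc', hk', hcu', hku'⟩ := T.exists_antiparallel_of_isPeriodicPt hqr hr hq'
  -- Both tangents are antiparallel to the one at `s`, hence equally oriented.
  have huu : T.curve u' = T.curve u := by
    refine T.curve_eq_of_deriv_eq_smul hT (k := k'⁻¹ * k) (by positivity) ?_
    rw [mul_smul, ← neg_eq_iff_eq_neg.2 hku, hku', neg_neg, inv_smul_smul₀ hk'.ne']
  refine hrne (T.curve_eq_of_deriv_eq_smul hT (k := c'⁻¹ * c) (by positivity) ?_)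
  rw [mul_smul, ← hcu, ← huu, hcu', inv_smul_smul₀ hc'.ne']

end ConvexTable

end SymplecticBilliard

theorem theorem2p5 (T : SymplecticBilliard.ConvexTable) :
    interior {p : T.phaseSpace | Function.IsPeriodicPt T.billiardMap 3 p} = ∅ ∧
      (StrictConvex ℝ T.table →
        interior {p : T.phaseSpace | Function.IsPeriodicPt T.billiardMap 4 p} = ∅) :=
  ⟨T.interior_isPeriodicPt_three, T.interior_isPeriodicPt_four⟩
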